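/- Let $(M,g)$ be a smooth Riemannian manifold of dimension $3$ with Levi-Civita connection $\nabla$, curvature tensor $R(X,Y)Z=\nabla_X\nabla_YZ-\nabla_Y\nabla_XZ-\nabla_{[X,Y]}Z$, Ricci tensor $S$, Ricci operator $Q$ (so that $g(QX,Y)=S(X,Y)$) and scalar curvature $r$. Let $(\varphi,\xi,\eta)$ be an almost contact metric structure on $(M,g)$: a smooth $(1,1)$-tensor field $\varphi$, a smooth vector field $\xi$ and a smooth $1$-form $\eta$ such that, for all $X,Y$, $$\varphi^2X=-X+\eta(X)\xi,\quad \eta(\xi)=1,\quad \eta(X)=g(X,\xi),\quad g(\varphi X,\varphi Y)=g(X,Y)-\eta(X)\eta(Y),\quad g(X,\varphi Y)+g(Y,\varphi X)=0 .$$ Suppose that the structure is trans-Sasakian of type $(\alpha,\beta)$, where $\alpha,\beta$ are smooth real functions on $M$: $$(\nabla_X\varphi)Y=\alpha\,[g(X,Y)\xi-\eta(Y)X]+\beta\,[g(\varphi X,Y)\xi-\eta(Y)\varphi X],$$ and that $M$ is connected or the function $\beta$ is constant. Let $\lambda,\mu$ be real constants such that $(g,\xi,\lambda,\mu)$ is an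 $\eta$-Einstein soliton: $$\mathcal L_\xi g+2S+(2\lambda-r)g+2\mu\,\eta\otimes\eta=0 .$$ Let $W_2(X,Y)Z=R(X,Y)Z+\tfrac12[g(X,Z)QY-g(Y,Z)QX]$ and suppose that $W_2(\xi,X)\cdot S=0$, that is, $$S(W_2(\xi,X)Y,Z)+S(Y,W_2(\xi,X)Z)=0\quad\text{for all }X,Y,Z .$$ Then at least one of the following holds. 1. $(M,g)$ is an Einstein manifold, that is, $S=c\,g$ for a real constant $c$, and $\beta=\mu$ everywhere. 2. $\beta$ is constant, $M$ has constant scalar curvature $r=2\lambda+2\beta$, and $\lambda=-\tfrac12(\mu+\beta)$; in particular the soliton is expanding ($\lambda>0$), steady ($\lambda=0$) or shrinking ($\lambda<0$) if and only if $\mu<-\beta$, $\mu=-\beta$ or $\mu>-\beta$, respectively. -/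

import Mathlib

open Bundle VectorField FiberBundle
open scoped Manifold ContDiff

noncomputable section

set_option linter.unusedSectionVars false

namespace TransSasakian

section LeviCivita

variable {E : Type*} [NormedAddCommGroup E] [NormedSpace ℝ E] [FiniteDimensional ℝ E]
  {H : Type*} [TopologicalSpace H] {I : ModelWithCorners ℝ E H}
  {M : Type*} [TopologicalSpace M] [ChartedSpace H M] [IsManifold I ∞ M]
  [RiemannianBundle (fun x : M ↦ TangentSpace I x)]
  [IsContMDiffRiemannianBundle I ∞ E (fun x : M ↦ TangentSpace I x)]

/-- The function `x ↦ g(X, Y)(x)` for vector fields `X`, `Y`. -/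
def metricFun (X Y : Π x : M, TangentSpace I x) (x : M) : ℝ := inner ℝ (X x) (Y x)

/-- The right-hand side of the Koszul formula for `2 g(∇_X Y, Z)`. -/
def koszul (X Y Z : Π x : M, TangentSpace I x) (x : M) : ℝ :=
  mvfderiv I (metricFun Y Z) x (X x) + mvfderiv I (metricFun Z X) x (Y x)
    - mvfderiv I (metricFun X Y) x (Z x)
    + inner ℝ (mlieBracket I X Y x) (Z x) - inner ℝ (mlieBracket I X Z x) (Y x)
    - inner ℝ (mlieBracket I Y Z x) (X x)

lemma mdifferentiableAt_metricFun {X Y : Π x : M, TangentSpace I x} {x : M}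
    (hX : MDiffAt (T% X) x) (hY : MDiffAt (T% Y) x) : MDiffAt (metricFun X Y) x :=
  MDifferentiableAt.inner_bundle (IB := I) (F := E) (E := fun x : M ↦ TangentSpace I x) hX hY

lemma metricFun_comm (X Y : Π x : M, TangentSpace I x) : metricFun X Y = metricFun Y X := by
  funext y; simp [metricFun, real_inner_comm]

lemma mvfderiv_metricFun_add {X X' Y : Π x : M, TangentSpace I x} {x : M}
    (hX : MDiffAt (T% X) x) (hX' : MDiffAt (T% X') x) (hY : MDiffAt (T% Y) x) :
    mvfderiv I (metricFun (X + X') Y) x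
      = mvfderiv I (metricFun X Y) x + mvfderiv I (metricFun X' Y) x := by
  have h : metricFun (X + X') Y = metricFun X Y + metricFun X' Y := by
    funext y; simp [metricFun, inner_add_left]
  rw [h, mvfderiv_add (mdifferentiableAt_metricFun hX hY) (mdifferentiableAt_metricFun hX' hY)]

lemma mvfderiv_metricFun_smul {f : M → ℝ} {X Y : Π x : M, TangentSpace I x} {x : M}
    (hf : MDiffAt f x) (hX : MDiffAt (T% X) x) (hY : MDiffAt (T% Y) x) :
    mvfderiv I (metricFun (f • X) Y) x
      = f x • mvfderiv I (metricFun X Y) x + metricFun X Y x • mvfderiv I f x := by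
  have h : metricFun (f • X) Y = f * metricFun X Y := by
    funext y; simp [metricFun, inner_smul_left]
  rw [h, mvfderiv_mul hf (mdifferentiableAt_metricFun hX hY)]

lemma koszul_add_left {X X' Y Z : Π x : M, TangentSpace I x} {x : M}
    (hX : MDiffAt (T% X) x) (hX' : MDiffAt (T% X') x) (hY : MDiffAt (T% Y) x)
    (hZ : MDiffAt (T% Z) x) :
    koszul (X + X') Y Z x = koszul X Y Z x + koszul X' Y Z x := by
  simp only [koszul, metricFun_comm Z, mvfderiv_metricFun_add hX hX' hY,
    mvfderiv_metricFun_add hX hX' hZ, mlieBracket_add_left hX hX']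
  simp [inner_add_left, inner_add_right]
  ring

lemma koszul_smul_left {f : M → ℝ} {X Y Z : Π x : M, TangentSpace I x} {x : M}
    (hf : MDiffAt f x) (hX : MDiffAt (T% X) x) (hY : MDiffAt (T% Y) x)
    (hZ : MDiffAt (T% Z) x) :
    koszul (f • X) Y Z x = f x * koszul X Y Z x := by
  simp only [koszul, metricFun_comm Z, mvfderiv_metricFun_smul hf hX hY,
    mvfderiv_metricFun_smul hf hX hZ, mlieBracket_smul_left hf hX]
  simp [inner_add_left, inner_smul_left, inner_smul_right, metricFun, real_inner_comm]
  ring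

lemma koszul_add_right {X Y Z Z' : Π x : M, TangentSpace I x} {x : M}
    (hX : MDiffAt (T% X) x) (hY : MDiffAt (T% Y) x) (hZ : MDiffAt (T% Z) x)
    (hZ' : MDiffAt (T% Z') x) :
    koszul X Y (Z + Z') x = koszul X Y Z x + koszul X Y Z' x := by
  simp only [koszul, metricFun_comm Y, mvfderiv_metricFun_add hZ hZ' hY,
    mvfderiv_metricFun_add hZ hZ' hX, mlieBracket_add_right hZ hZ']
  simp [inner_add_left, inner_add_right]
  ring

lemma koszul_smul_right {f : M → ℝ} {X Y Z : Π x : M, TangentSpace I x} {x : M}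
    (hf : MDiffAt f x) (hX : MDiffAt (T% X) x) (hY : MDiffAt (T% Y) x)
    (hZ : MDiffAt (T% Z) x) :
    koszul X Y (f • Z) x = f x * koszul X Y Z x := by
  simp only [koszul, metricFun_comm Y, mvfderiv_metricFun_smul hf hZ hY,
    mvfderiv_metricFun_smul hf hZ hX, mlieBracket_smul_right hf hZ]
  simp [inner_add_left, inner_smul_left, inner_smul_right, metricFun, real_inner_comm]
  ring

lemma koszul_add_middle {X Y Y' Z : Π x : M, TangentSpace I x} {x : M}
    (hX : MDiffAt (T% X) x) (hY : MDiffAt (T% Y) x) (hY' : MDiffAt (T% Y') x)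
    (hZ : MDiffAt (T% Z) x) :
    koszul X (Y + Y') Z x = koszul X Y Z x + koszul X Y' Z x := by
  simp only [koszul, metricFun_comm X, mvfderiv_metricFun_add hY hY' hZ,
    mvfderiv_metricFun_add hY hY' hX, mlieBracket_add_left hY hY', mlieBracket_add_right hY hY']
  simp [inner_add_left, inner_add_right]
  ring

lemma koszul_smul_middle {f : M → ℝ} {X Y Z : Π x : M, TangentSpace I x} {x : M}
    (hf : MDiffAt f x) (hX : MDiffAt (T% X) x) (hY : MDiffAt (T% Y) x)
    (hZ : MDiffAt (T% Z) x) :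
    koszul X (f • Y) Z x
      = f x * koszul X Y Z x + 2 * (mvfderiv I f x (X x) * inner ℝ (Y x) (Z x)) := by
  simp only [koszul, metricFun_comm X, mvfderiv_metricFun_smul hf hY hZ,
    mvfderiv_metricFun_smul hf hY hX, mlieBracket_smul_left hf hY, mlieBracket_smul_right hf hY]
  simp [inner_add_left, inner_smul_left, inner_smul_right, metricFun, real_inner_comm]
  ring

lemma tensorialAt_koszul_left {Y Z : Π x : M, TangentSpace I x} {x : M}
    (hY : MDiffAt (T% Y) x) (hZ : MDiffAt (T% Z) x) :
    TensorialAt I E (fun X : Π x : M, TangentSpace I x ↦ koszul X Y Z x) x where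
  smul hf hX := by simp [koszul_smul_left hf hX hY hZ]
  add hX hX' := koszul_add_left hX hX' hY hZ

lemma tensorialAt_koszul_right {X Y : Π x : M, TangentSpace I x} {x : M}
    (hX : MDiffAt (T% X) x) (hY : MDiffAt (T% Y) x) :
    TensorialAt I E (fun Z : Π x : M, TangentSpace I x ↦ koszul X Y Z x) x where
  smul hf hZ := by simp [koszul_smul_right hf hX hY hZ]
  add hZ hZ' := koszul_add_right hX hY hZ hZ'

/-- For `Y` differentiable at `x`, the bilinear form `(u, w) ↦ 2 g(∇_u Y, w)` on `T_x M` given by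
the Koszul formula. -/
def koszulForm (Y : Π x : M, TangentSpace I x) (x : M) (hY : MDiffAt (T% Y) x) :
    TangentSpace I x →L[ℝ] TangentSpace I x →L[ℝ] ℝ :=
  TensorialAt.mkHom₂ (I := I) (F := E) (F' := E) (fun X Z ↦ koszul X Y Z x) x
    (fun _ hZ ↦ tensorialAt_koszul_left hY hZ) (fun _ hX ↦ tensorialAt_koszul_right hX hY)

instance (x : M) : FiniteDimensional ℝ (TangentSpace I x) :=
  inferInstanceAs (FiniteDimensional ℝ E)

open Classical in
/-- The Levi-Civita derivative `u ↦ ∇_u Y` at `x`. -/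
def leviCivitaFun (Y : Π x : M, TangentSpace I x) (x : M) :
    TangentSpace I x →L[ℝ] TangentSpace I x :=
  if hY : MDiffAt (T% Y) x then
    ∑ i, ((1 / 2 : ℝ) • (koszulForm Y x hY).flip
      (stdOrthonormalBasis ℝ (TangentSpace I x) i)).smulRight
        (stdOrthonormalBasis ℝ (TangentSpace I x) i)
  else 0

lemma koszulForm_apply {X Y Z : Π x : M, TangentSpace I x} {x : M}
    (hX : MDiffAt (T% X) x) (hY : MDiffAt (T% Y) x) (hZ : MDiffAt (T% Z) x) :
    koszulForm Y x hY (X x) (Z x) = koszul X Y Z x :=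
  TensorialAt.mkHom₂_apply (I := I) (F := E) (F' := E) _ _ hX hZ

/-- The Koszul formula at a point, with `u`, `w` extended to local vector fields. -/
lemma inner_leviCivitaFun {Y : Π x : M, TangentSpace I x} {x : M} (hY : MDiffAt (T% Y) x)
    (u w : TangentSpace I x) :
    inner ℝ (leviCivitaFun Y x u) w = 1 / 2 * koszul (extend E u) Y (extend E w) x := by
  have h : koszul (extend E u) Y (extend E w) x = koszulForm Y x hY u w := by
    rw [← koszulForm_apply (mdifferentiableAt_extend I E u) hY (mdifferentiableAt_extend I E w)]
    simp
  rw [h, leviCivitaFun, dif_pos hY]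
  conv_rhs => rw [← (stdOrthonormalBasis ℝ (TangentSpace I x)).sum_repr' w]
  simp only [sum_apply, ContinuousLinearMap.smulRight_apply, sum_inner,
    inner_smul_left, map_sum, map_smul, Finset.mul_sum]
  refine Finset.sum_congr rfl fun i _ ↦ ?_
  simp
  ring

lemma isCovariantDerivativeOn_leviCivitaFun :
    IsCovariantDerivativeOn E
      (leviCivitaFun : (Π x : M, TangentSpace I x) → Π x : M, TangentSpace I x →L[ℝ] _) where
  add {Y Y' x} hY hY' _ := by
    ext u
    refine ext_inner_right ℝ fun w ↦ ?_
    have hu := mdifferentiableAt_extend I E u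
    have hw := mdifferentiableAt_extend I E w
    rw [add_apply, inner_add_left, inner_leviCivitaFun hY,
      inner_leviCivitaFun hY', inner_leviCivitaFun (mdifferentiableAt_add_section hY hY'),
      koszul_add_middle hu hY hY' hw]
    ring
  leibniz {Y f x} hY hf _ := by
    ext u
    refine ext_inner_right ℝ fun w ↦ ?_
    have hu := mdifferentiableAt_extend I E u
    have hw := mdifferentiableAt_extend I E w
    rw [add_apply, inner_add_left, smul_apply,
      inner_smul_left, inner_leviCivitaFun hY, inner_leviCivitaFun (hf.smul_section hY),
      koszul_smul_middle hf hu hY hw]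
    simp [inner_smul_left]
    ring

/-- The Levi-Civita connection `∇` of the Riemannian metric: `leviCivita Y x u` is `∇_u Y`. -/
def leviCivita : CovariantDerivative I E (TangentSpace I : M → Type _) where
  toFun := leviCivitaFun
  isCovariantDerivativeOnUniv := isCovariantDerivativeOn_leviCivitaFun

lemma two_mul_inner_leviCivita {X Y Z : Π x : M, TangentSpace I x} {x : M}
    (hX : MDiffAt (T% X) x) (hY : MDiffAt (T% Y) x) (hZ : MDiffAt (T% Z) x) :
    2 * inner ℝ (leviCivita Y x (X x)) (Z x) = koszul X Y Z x := by
  change 2 * inner ℝ (leviCivitaFun Y x (X x)) (Z x) = _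
  rw [inner_leviCivitaFun hY, ← koszulForm_apply hX hY hZ,
    ← koszulForm_apply (mdifferentiableAt_extend I E _) hY (mdifferentiableAt_extend I E _)]
  simp

/-- The Levi-Civita connection is torsion-free. -/
theorem leviCivita_torsion {X Y : Π x : M, TangentSpace I x} {x : M}
    (hX : MDiffAt (T% X) x) (hY : MDiffAt (T% Y) x) :
    leviCivita Y x (X x) - leviCivita X x (Y x) = mlieBracket I X Y x := by
  refine ext_inner_right ℝ fun w ↦ ?_
  have hw := mdifferentiableAt_extend I E w
  have h1 := two_mul_inner_leviCivita hX hY hw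
  have h2 := two_mul_inner_leviCivita hY hX hw
  have h3 : mlieBracket I Y X x = -mlieBracket I X Y x := mlieBracket_swap_apply
  simp only [koszul, extend_apply_self, metricFun_comm Y X, metricFun_comm (extend E w), h3,
    inner_neg_left] at h1 h2
  rw [inner_sub_left]
  linarith

/-- The Levi-Civita connection is compatible with the metric. -/
theorem leviCivita_metric {X Y Z : Π x : M, TangentSpace I x} {x : M}
    (hX : MDiffAt (T% X) x) (hY : MDiffAt (T% Y) x) (hZ : MDiffAt (T% Z) x) :
    mvfderiv I (metricFun Y Z) x (X x)
      = inner ℝ (leviCivita Y x (X x)) (Z x) + inner ℝ (Y x) (leviCivita Z x (X x)) := by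
  have h1 := two_mul_inner_leviCivita hX hY hZ
  have h2 := two_mul_inner_leviCivita hX hZ hY
  have h3 : mlieBracket I Z Y x = -mlieBracket I Y Z x := mlieBracket_swap_apply
  rw [real_inner_comm] at h2
  simp only [koszul, metricFun_comm Z, metricFun_comm Y X, h3, inner_neg_left] at h1 h2
  linarith

end LeviCivita

section Curvature

variable {E : Type*} [NormedAddCommGroup E] [NormedSpace ℝ E] [FiniteDimensional ℝ E]
  {H : Type*} [TopologicalSpace H] {I : ModelWithCorners ℝ E H}
  {M : Type*} [TopologicalSpace M] [ChartedSpace H M] [IsManifold I ∞ M]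
  [RiemannianBundle (fun x : M ↦ TangentSpace I x)]
  [IsContMDiffRiemannianBundle I ∞ E (fun x : M ↦ TangentSpace I x)]

/-- `R(X, Y)Z = ∇_X ∇_Y Z - ∇_Y ∇_X Z - ∇_{[X, Y]} Z` for vector fields. -/
def curvatureField (X Y Z : Π x : M, TangentSpace I x) (x : M) : TangentSpace I x :=
  leviCivita (fun y ↦ leviCivita Z y (Y y)) x (X x)
    - leviCivita (fun y ↦ leviCivita Z y (X y)) x (Y x)
    - leviCivita Z x (mlieBracket I X Y x)

/-- The curvature tensor `R(u, v)w` at `x`. By tensoriality any local smooth extensions of the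
tangent vectors give the same value; `extend` is the extension with constant coefficients in the
preferred chart at `x`. -/
def curvature (x : M) (u v w : TangentSpace I x) : TangentSpace I x :=
  curvatureField (extend E u) (extend E v) (extend E w) x

/-- The Ricci tensor `S(v, w) = tr (u ↦ R(u, v)w)`, the trace being computed in an orthonormal
basis of the tangent space. -/
def ricci (x : M) (v w : TangentSpace I x) : ℝ :=
  ∑ i, inner ℝ (curvature x (stdOrthonormalBasis ℝ (TangentSpace I x) i) v w)
    (stdOrthonormalBasis ℝ (TangentSpace I x) i)

/-- The Ricci operator `Q`, with `g(Qv, w) = S(v, w)`. -/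
def ricciOp (x : M) (v : TangentSpace I x) : TangentSpace I x :=
  ∑ i, ricci x v (stdOrthonormalBasis ℝ (TangentSpace I x) i) •
    stdOrthonormalBasis ℝ (TangentSpace I x) i

variable (I) in
/-- The scalar curvature `r`, the trace of the Ricci tensor. -/
def scalarCurvature (x : M) : ℝ :=
  ∑ i, ricci x (stdOrthonormalBasis ℝ (TangentSpace I x) i)
    (stdOrthonormalBasis ℝ (TangentSpace I x) i)

/-- The `W₂`-curvature tensor of a three-dimensional Riemannian manifold. -/
def w2 (x : M) (u v w : TangentSpace I x) : TangentSpace I x :=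
  curvature x u v w
    + (1 / 2 : ℝ) • ((inner ℝ u w : ℝ) • ricciOp x v - (inner ℝ v w : ℝ) • ricciOp x u)

variable (I M) in
/-- The Riemannian manifold is Einstein: its Ricci tensor is a constant multiple of the metric. -/
def IsEinstein : Prop :=
  ∃ c : ℝ, ∀ (x : M) (u v : TangentSpace I x), ricci x u v = c * inner ℝ u v

/-- The Lie derivative `(𝓛_V g)(X, Y)` of the metric. -/
def lieDerivMetric (V X Y : Π x : M, TangentSpace I x) (x : M) : ℝ :=
  mvfderiv I (metricFun X Y) x (V x)
    - inner ℝ (mlieBracket I V X x) (Y x) - inner ℝ (X x) (mlieBracket I V Y x)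

end Curvature

section Contact

variable {E : Type*} [NormedAddCommGroup E] [NormedSpace ℝ E] [FiniteDimensional ℝ E]
  {H : Type*} [TopologicalSpace H] (I : ModelWithCorners ℝ E H)
  (M : Type*) [TopologicalSpace M] [ChartedSpace H M] [IsManifold I ∞ M]
  [RiemannianBundle (fun x : M ↦ TangentSpace I x)]
  [IsContMDiffRiemannianBundle I ∞ E (fun x : M ↦ TangentSpace I x)]

/-- An almost contact metric structure `(φ, ξ, η)` on a Riemannian manifold `(M, g)`. -/
structure AlmostContactMetric where
  /-- the `(1, 1)`-tensor field `φ` -/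
  phi (x : M) : TangentSpace I x →L[ℝ] TangentSpace I x
  /-- the characteristic vector field `ξ` -/
  xi (x : M) : TangentSpace I x
  /-- the `1`-form `η` -/
  eta (x : M) : TangentSpace I x →L[ℝ] ℝ
  smooth_phi : ContMDiff I (I.prod 𝓘(ℝ, E →L[ℝ] E)) ∞
    (fun x ↦ TotalSpace.mk' (E →L[ℝ] E) x (phi x))
  smooth_xi : ContMDiff I (I.prod 𝓘(ℝ, E)) ∞ (fun x ↦ TotalSpace.mk' E x (xi x))
  smooth_eta : ContMDiff I (I.prod 𝓘(ℝ, E →L[ℝ] ℝ)) ∞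
    (fun x ↦ TotalSpace.mk' (E →L[ℝ] ℝ) x (eta x))
  phi_phi (x : M) (u : TangentSpace I x) : phi x (phi x u) = -u + eta x u • xi x
  eta_xi (x : M) : eta x (xi x) = 1
  eta_apply (x : M) (u : TangentSpace I x) : eta x u = inner ℝ u (xi x)
  inner_phi_phi (x : M) (u v : TangentSpace I x) :
    inner ℝ (phi x u) (phi x v) = inner ℝ u v - eta x u * eta x v
  inner_phi_skew (x : M) (u v : TangentSpace I x) :
    inner ℝ u (phi x v) + inner ℝ v (phi x u) = 0

variable {I M}

namespace AlmostContactMetric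

variable (A : AlmostContactMetric I M)

/-- The covariant derivative `(∇_u φ)Y = ∇_u (φY) - φ(∇_u Y)` at `x`. -/
def covDerivPhi (Y : Π x : M, TangentSpace I x) (x : M) (u : TangentSpace I x) :
    TangentSpace I x :=
  leviCivita (fun y ↦ A.phi y (Y y)) x u - A.phi x (leviCivita Y x u)

/-- The structure is trans-Sasakian of type `(α, β)`: `α`, `β` are smooth functions and
`(∇_X φ)Y = α (g(X, Y)ξ - η(Y)X) + β (g(φX, Y)ξ - η(Y)φX)`. -/
structure IsTransSasakian (α β : M → ℝ) : Prop where
  smooth_alpha : ContMDiff I 𝓘(ℝ) ∞ α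
  smooth_beta : ContMDiff I 𝓘(ℝ) ∞ β
  covDerivPhi_eq (x : M) (u : TangentSpace I x) (Y : Π x : M, TangentSpace I x)
    (hY : MDiffAt (T% Y) x) :
    A.covDerivPhi Y x u
      = α x • ((inner ℝ u (Y x) : ℝ) • A.xi x - A.eta x (Y x) • u)
        + β x • ((inner ℝ (A.phi x u) (Y x) : ℝ) • A.xi x - A.eta x (Y x) • A.phi x u)

/-- `(g, ξ, lam, mu)` is an `η`-Einstein soliton:
`𝓛_ξ g + 2 S + (2 lam - r) g + 2 mu η ⊗ η = 0`. -/
def IsEtaEinsteinSoliton (lam mu : ℝ) : Prop :=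
  ∀ (x : M) (X Y : Π x : M, TangentSpace I x), MDiffAt (T% X) x → MDiffAt (T% Y) x →
    lieDerivMetric A.xi X Y x + 2 * ricci x (X x) (Y x)
      + (2 * lam - scalarCurvature I x) * inner ℝ (X x) (Y x)
      + 2 * mu * (A.eta x (X x) * A.eta x (Y x)) = 0

/-- The curvature condition `W₂(ξ, X) · S = 0`. -/
def W2DotRicciEqZero : Prop :=
  ∀ (x : M) (u v w : TangentSpace I x),
    ricci x (w2 x (A.xi x) u v) w + ricci x v (w2 x (A.xi x) u w) = 0

end AlmostContactMetric

end Contact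

end TransSasakian

end

set_option linter.unusedSectionVars false

namespace TransSasakian

open Filter Topology InnerProductSpace

section Smoothness

variable {E : Type*} [NormedAddCommGroup E] [NormedSpace ℝ E] [FiniteDimensional ℝ E]
  {H : Type*} [TopologicalSpace H] {I : ModelWithCorners ℝ E H}
  {M : Type*} [TopologicalSpace M] [ChartedSpace H M] [IsManifold I ∞ M]

lemma mvfderiv_congr {f g : M → ℝ} {x : M} (h : f =ᶠ[𝓝 x] g) :
    mvfderiv I f x = mvfderiv I g x := by
  rw [mvfderiv, mvfderiv, h.mfderiv_eq, h.eq_of_nhds]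

lemma eventually_mdifferentiableAt {f : M → ℝ} {x : M} (hf : CMDiffAt ∞ f x) :
    ∀ᶠ y in 𝓝 x, MDiffAt f y :=
  ((contMDiffAt_iff_contMDiffAt_nhds (n := 1) (by simp)).1 (hf.of_le (by simp))).mono
    fun _ h ↦ h.mdifferentiableAt one_ne_zero

lemma eventually_mdifferentiableAt_field {X : Π x : M, TangentSpace I x} {x : M}
    (hX : CMDiffAt ∞ (T% X) x) : ∀ᶠ y in 𝓝 x, MDiffAt (T% X) y := by
  have := IsManifold.of_le (I := I) (M := M) (m := 1 + 1) (n := ∞) (by simpa using (by decide))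
  exact ((contMDiffAt_iff_contMDiffAt_nhds (n := 1) (by simp)).1 (hX.of_le (by simp))).mono
    fun _ h ↦ h.mdifferentiableAt one_ne_zero

lemma contMDiffAt_mlieBracket {X Y : Π x : M, TangentSpace I x} {x : M}
    (hX : CMDiffAt ∞ (T% X) x) (hY : CMDiffAt ∞ (T% Y) x) :
    CMDiffAt ∞ (T% (mlieBracket I X Y)) x := by
  have : CompleteSpace E := FiniteDimensional.complete ℝ E
  have : IsManifold I (minSmoothness ℝ 2) M := .of_le (n := ∞) (by simpa using (by decide))
  have : IsManifold I (((⊤ : ℕ∞) : ℕ∞ω) + 1) M := .of_le (n := ∞) (by simp)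
  exact ContMDiffAt.mlieBracket_vectorField (m := ⊤) (n := ⊤) hX hY (by simp)

variable [RiemannianBundle (fun x : M ↦ TangentSpace I x)]
  [IsContMDiffRiemannianBundle I ∞ E (fun x : M ↦ TangentSpace I x)]

lemma contMDiffAt_metricFun {X Y : Π x : M, TangentSpace I x} {x : M}
    (hX : CMDiffAt ∞ (T% X) x) (hY : CMDiffAt ∞ (T% Y) x) : CMDiffAt ∞ (metricFun X Y) x :=
  ContMDiffAt.inner_bundle (IB := I) (F := E) (E := fun x : M ↦ TangentSpace I x) hX hY

lemma contMDiffAt_mvfderiv [Nontrivial E] {f : M → ℝ} {X : Π x : M, TangentSpace I x} {x : M}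
    (hf : CMDiffAt ∞ f x) (hX : CMDiffAt ∞ (T% X) x) :
    CMDiffAt ∞ (fun y ↦ mvfderiv I f y (X y)) x := by
  obtain ⟨w, hw⟩ : ∃ w : TangentSpace I x, w ≠ 0 := exists_ne (0 : E)
  set Z := extend E w
  have hZ : CMDiffAt ∞ (T% Z) x := contMDiffAt_extend I E w
  have hZx : metricFun Z Z x ≠ 0 := by simp [metricFun, Z, hw]
  have hZZ := contMDiffAt_metricFun hZ hZ
  have h := (contMDiffAt_metricFun ((contMDiffAt_mlieBracket hX (hf.smul_section hZ)).sub_section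
    (hf.smul_section (contMDiffAt_mlieBracket hX hZ))) hZ).div₀ hZZ hZx
  refine h.congr_of_eventuallyEq ?_
  filter_upwards [eventually_mdifferentiableAt hf, eventually_mdifferentiableAt_field hZ,
    hZZ.continuousAt.eventually_ne hZx] with y hfy hZy hy
  rw [Pi.div_apply, eq_div_iff hy, metricFun, metricFun, Pi.sub_apply,
    mlieBracket_smul_right hfy hZy]
  simp [inner_smul_left]

/-- `[X, Y] f = X (Y f) - Y (X f)`. -/
lemma mvfderiv_mlieBracket [Nontrivial E] {f : M → ℝ} {X Y : Π x : M, TangentSpace I x} {x : M}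
    (hf : CMDiffAt ∞ f x) (hX : CMDiffAt ∞ (T% X) x) (hY : CMDiffAt ∞ (T% Y) x) :
    mvfderiv I f x (mlieBracket I X Y x) =
      mvfderiv I (fun y ↦ mvfderiv I f y (Y y)) x (X x)
        - mvfderiv I (fun y ↦ mvfderiv I f y (X y)) x (Y x) := by
  have : CompleteSpace E := FiniteDimensional.complete ℝ E
  have : IsManifold I (minSmoothness ℝ 3) M := .of_le (n := ∞) (by simpa using (by decide))
  obtain ⟨w, hw⟩ : ∃ w : TangentSpace I x, w ≠ 0 := exists_ne (0 : E)
  set Z := extend E w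
  have hZ : CMDiffAt ∞ (T% Z) x := contMDiffAt_extend I E w
  have hZx : Z x = w := extend_apply_self E w
  have top_ne : (∞ : ℕ∞ω) ≠ 0 := by simp
  have two_le : minSmoothness ℝ 2 ≤ (∞ : ℕ∞ω) := by simpa using (by decide)
  have key : ∀ X Y : Π x : M, TangentSpace I x, CMDiffAt ∞ (T% X) x → CMDiffAt ∞ (T% Y) x →
      mlieBracket I X (mlieBracket I Y (f • Z)) x =
        mvfderiv I (fun y ↦ mvfderiv I f y (Y y)) x (X x) • Z x
          + mvfderiv I f x (Y x) • mlieBracket I X Z x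
          + mvfderiv I f x (X x) • mlieBracket I Y Z x
          + f x • mlieBracket I X (mlieBracket I Y Z) x := by
    intro X Y hX hY
    have h : mlieBracket I Y (f • Z) =ᶠ[𝓝 x]
        (fun y ↦ mvfderiv I f y (Y y)) • Z + f • mlieBracket I Y Z := by
      filter_upwards [eventually_mdifferentiableAt hf, eventually_mdifferentiableAt_field hZ]
        with y hfy hZy
      rw [mlieBracket_smul_right hfy hZy]
      rfl
    have hd := contMDiffAt_mvfderiv hf hY
    have hB := contMDiffAt_mlieBracket hY hZ
    rw [EventuallyEq.rfl.mlieBracket_vectorField_eq h,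
      mlieBracket_add_right ((hd.smul_section hZ).mdifferentiableAt top_ne)
        ((hf.smul_section hB).mdifferentiableAt top_ne),
      mlieBracket_smul_right (hd.mdifferentiableAt top_ne) (hZ.mdifferentiableAt top_ne),
      mlieBracket_smul_right (hf.mdifferentiableAt top_ne) (hB.mdifferentiableAt top_ne)]
    abel
  have hfZ := hf.smul_section hZ
  have h1 := leibniz_identity_mlieBracket_apply (hX.of_le two_le) (hY.of_le two_le)
    (hfZ.of_le two_le)
  have h2 := leibniz_identity_mlieBracket_apply (hX.of_le two_le) (hY.of_le two_le)
    (hZ.of_le two_le)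
  rw [key X Y hX hY, key Y X hY hX, mlieBracket_smul_right (hf.mdifferentiableAt top_ne)
    (hZ.mdifferentiableAt top_ne), h2, hZx] at h1
  have h3 : (mvfderiv I f x (mlieBracket I X Y x) -
      (mvfderiv I (fun y ↦ mvfderiv I f y (Y y)) x (X x)
        - mvfderiv I (fun y ↦ mvfderiv I f y (X y)) x (Y x))) • w = 0 := by
    rw [← neg_eq_zero, ← sub_eq_zero.2 h1]
    module
  exact sub_eq_zero.1 ((smul_eq_zero.1 h3).resolve_right hw)

lemma contMDiffAt_gramSchmidt {n : ℕ} {s : Fin n → Π x : M, TangentSpace I x} {x : M}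
    (hs : ∀ i, CMDiffAt ∞ (T% (s i)) x) (hli : LinearIndependent ℝ (fun i ↦ s i x)) (i : Fin n) :
    CMDiffAt ∞ (T% (fun y ↦ gramSchmidt ℝ (fun j ↦ s j y) i)) x := by
  induction i using WellFoundedLT.induction with
  | ind i ih =>
  have h : (fun y ↦ gramSchmidt ℝ (fun j ↦ s j y) i) = s i - (fun y ↦ ∑ j ∈ Finset.Iio i,
      ((metricFun (fun y ↦ gramSchmidt ℝ (fun j ↦ s j y) j) (s i) /
        metricFun (fun y ↦ gramSchmidt ℝ (fun j ↦ s j y) j)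
          (fun y ↦ gramSchmidt ℝ (fun j ↦ s j y) j)) •
        (fun y ↦ gramSchmidt ℝ (fun j ↦ s j y) j)) y) := by
    funext y
    rw [gramSchmidt_def]
    simp only [Submodule.starProjection_singleton, Pi.sub_apply, Pi.smul_apply', Pi.div_apply,
      metricFun, real_inner_self_eq_norm_sq]
    rfl
  refine ((hs i).sub_section (.sum_section fun j hj ↦ ?_)).congr_of_eventuallyEq
    (.of_forall fun y ↦ congrArg (TotalSpace.mk y) (congrFun h y))
  have hj := ih j (Finset.mem_Iio.1 hj)
  refine ((contMDiffAt_metricFun hj (hs i)).div₀ (contMDiffAt_metricFun hj hj) ?_).smul_section hj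
  simpa [metricFun] using gramSchmidt_ne_zero j hli

/-- A vector field whose inner products with smooth vector fields are smooth is smooth. -/
lemma contMDiffAt_of_metricFun {X : Π x : M, TangentSpace I x} {x : M}
    (h : ∀ Y : Π x : M, TangentSpace I x, CMDiffAt ∞ (T% Y) x → CMDiffAt ∞ (metricFun X Y) x) :
    CMDiffAt ∞ (T% X) x := by
  set b := Module.finBasis ℝ E
  set e := trivializationAt E (TangentSpace I : M → Type _) x
  have hx : x ∈ e.baseSet := FiberBundle.mem_baseSet_trivializationAt' x
  have hfr := e.isLocalFrameOn_localFrame_baseSet I ∞ b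
  set s := e.localFrame b
  set u : Fin (Module.finrank ℝ E) → Π x : M, TangentSpace I x :=
    fun i y ↦ gramSchmidt ℝ (fun j ↦ s j y) i
  have hu : ∀ i, CMDiffAt ∞ (T% (u i)) x := fun i ↦
    contMDiffAt_gramSchmidt (fun j ↦ hfr.contMDiffAt e.open_baseSet hx j)
      (hfr.linearIndependent hx) i
  have huu : ∀ i, metricFun (u i) (u i) x ≠ 0 := fun i ↦ by
    simpa [metricFun, u] using gramSchmidt_ne_zero i (hfr.linearIndependent hx)
  have hsum : CMDiffAt ∞ (T% (fun y ↦ ∑ i, ((metricFun X (u i) / metricFun (u i) (u i)) • u i) y))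
      x := .sum_section fun i _ ↦
    ((h _ (hu i)).div₀ (contMDiffAt_metricFun (hu i) (hu i)) (huu i)).smul_section (hu i)
  refine hsum.congr_of_eventuallyEq ?_
  filter_upwards [e.open_baseSet.mem_nhds hx] with y hy
  congr 1
  have hne : ∀ i, u i y ≠ 0 := fun i ↦ gramSchmidt_ne_zero i (hfr.linearIndependent hy)
  have hspan : Submodule.span ℝ (Set.range fun i ↦ u i y) = ⊤ := by
    rw [show (fun i ↦ u i y) = gramSchmidt ℝ (fun j ↦ s j y) from rfl, span_gramSchmidt]
    exact top_le_iff.1 (hfr.generating hy)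
  rw [← sub_eq_zero, ← Submodule.mem_bot ℝ, ← Submodule.top_orthogonal_eq_bot, ← hspan,
    Submodule.mem_orthogonal]
  intro v hv
  induction hv using Submodule.span_induction with
  | zero => simp
  | add v w _ _ hv hw => rw [inner_add_left, hv, hw, add_zero]
  | smul a v _ hv => rw [inner_smul_left, hv, mul_zero]
  | mem v hv =>
    obtain ⟨i, rfl⟩ := hv
    simp only [inner_sub_right, inner_sum, Pi.smul_apply', Pi.div_apply, inner_smul_right,
      metricFun]
    rw [Finset.sum_eq_single i]
    · rw [div_mul_cancel₀ _ (by simpa using hne i), real_inner_comm, sub_self]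
    · intro j _ hj
      rw [show inner ℝ (u i y) (u j y) = (0 : ℝ) from gramSchmidt_orthogonal ℝ _ hj.symm, mul_zero]
    · simp

lemma contMDiffAt_koszul [Nontrivial E] {X Y Z : Π x : M, TangentSpace I x} {x : M}
    (hX : CMDiffAt ∞ (T% X) x) (hY : CMDiffAt ∞ (T% Y) x) (hZ : CMDiffAt ∞ (T% Z) x) :
    CMDiffAt ∞ (koszul X Y Z) x :=
  (((((contMDiffAt_mvfderiv (contMDiffAt_metricFun hY hZ) hX).add
    (contMDiffAt_mvfderiv (contMDiffAt_metricFun hZ hX) hY)).sub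
    (contMDiffAt_mvfderiv (contMDiffAt_metricFun hX hY) hZ)).add
    (contMDiffAt_metricFun (contMDiffAt_mlieBracket hX hY) hZ)).sub
    (contMDiffAt_metricFun (contMDiffAt_mlieBracket hX hZ) hY)).sub
    (contMDiffAt_metricFun (contMDiffAt_mlieBracket hY hZ) hX)

lemma contMDiffAt_leviCivita [Nontrivial E] {X Y : Π x : M, TangentSpace I x} {x : M}
    (hX : CMDiffAt ∞ (T% X) x) (hY : CMDiffAt ∞ (T% Y) x) :
    CMDiffAt ∞ (T% (fun y ↦ leviCivita Y y (X y))) x := by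
  refine contMDiffAt_of_metricFun fun Z hZ ↦ ?_
  have h : CMDiffAt ∞ (fun y ↦ (1 / 2 : ℝ) * koszul X Y Z y) x :=
    contMDiffAt_const.mul (contMDiffAt_koszul hX hY hZ)
  refine h.congr_of_eventuallyEq ?_
  filter_upwards [eventually_mdifferentiableAt_field hX, eventually_mdifferentiableAt_field hY,
    eventually_mdifferentiableAt_field hZ] with y hXy hYy hZy
  rw [← two_mul_inner_leviCivita hXy hYy hZy, metricFun]
  ring

end Smoothness

section CurvatureSymmetries

variable {E : Type*} [NormedAddCommGroup E] [NormedSpace ℝ E] [FiniteDimensional ℝ E]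
  {H : Type*} [TopologicalSpace H] {I : ModelWithCorners ℝ E H}
  {M : Type*} [TopologicalSpace M] [ChartedSpace H M] [IsManifold I ∞ M]
  [RiemannianBundle (fun x : M ↦ TangentSpace I x)]
  [IsContMDiffRiemannianBundle I ∞ E (fun x : M ↦ TangentSpace I x)]

lemma mvfderiv_mvfderiv_metricFun [Nontrivial E] {X Y Z W : Π x : M, TangentSpace I x} {x : M}
    (hX : CMDiffAt ∞ (T% X) x) (hY : CMDiffAt ∞ (T% Y) x) (hZ : CMDiffAt ∞ (T% Z) x)
    (hW : CMDiffAt ∞ (T% W) x) :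
    mvfderiv I (fun y ↦ mvfderiv I (metricFun Z W) y (Y y)) x (X x) =
      inner ℝ (leviCivita (fun y ↦ leviCivita Z y (Y y)) x (X x)) (W x)
        + inner ℝ (leviCivita Z x (Y x)) (leviCivita W x (X x))
        + (inner ℝ (leviCivita Z x (X x)) (leviCivita W x (Y x))
        + inner ℝ (Z x) (leviCivita (fun y ↦ leviCivita W y (Y y)) x (X x))) := by
  have top_ne : (∞ : ℕ∞ω) ≠ 0 := by simp
  have h : (fun y ↦ mvfderiv I (metricFun Z W) y (Y y)) =ᶠ[𝓝 x]
      metricFun (fun y ↦ leviCivita Z y (Y y)) W + metricFun Z (fun y ↦ leviCivita W y (Y y)) := by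
    filter_upwards [eventually_mdifferentiableAt_field hY, eventually_mdifferentiableAt_field hZ,
      eventually_mdifferentiableAt_field hW] with y hYy hZy hWy
    exact leviCivita_metric hYy hZy hWy
  have hYZ := (contMDiffAt_leviCivita hY hZ).mdifferentiableAt top_ne
  have hYW := (contMDiffAt_leviCivita hY hW).mdifferentiableAt top_ne
  have hX := hX.mdifferentiableAt top_ne
  have hZ := hZ.mdifferentiableAt top_ne
  have hW := hW.mdifferentiableAt top_ne
  rw [mvfderiv_congr h, mvfderiv_add (mdifferentiableAt_metricFun hYZ hW)
    (mdifferentiableAt_metricFun hZ hYW), add_apply,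
    leviCivita_metric hX hYZ hW, leviCivita_metric hX hZ hYW]

lemma inner_curvatureField_skew [Nontrivial E] {X Y Z W : Π x : M, TangentSpace I x} {x : M}
    (hX : CMDiffAt ∞ (T% X) x) (hY : CMDiffAt ∞ (T% Y) x) (hZ : CMDiffAt ∞ (T% Z) x)
    (hW : CMDiffAt ∞ (T% W) x) :
    inner ℝ (curvatureField X Y Z x) (W x) + inner ℝ (Z x) (curvatureField X Y W x) = 0 := by
  have top_ne : (∞ : ℕ∞ω) ≠ 0 := by simp
  have h1 := mvfderiv_mlieBracket (contMDiffAt_metricFun hZ hW) hX hY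
  rw [mvfderiv_mvfderiv_metricFun hX hY hZ hW, mvfderiv_mvfderiv_metricFun hY hX hZ hW,
    leviCivita_metric ((contMDiffAt_mlieBracket hX hY).mdifferentiableAt top_ne)
      (hZ.mdifferentiableAt top_ne) (hW.mdifferentiableAt top_ne)] at h1
  simp only [curvatureField, inner_sub_left, inner_sub_right]
  linarith

lemma inner_curvature_skew [Nontrivial E] (x : M) (u v w z : TangentSpace I x) :
    inner ℝ (curvature x u v w) z = -inner ℝ (curvature x u v z) w := by
  have h := inner_curvatureField_skew (contMDiffAt_extend I E u) (contMDiffAt_extend I E v)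
    (contMDiffAt_extend I E w) (contMDiffAt_extend I E z)
  rw [extend_apply_self, extend_apply_self, real_inner_comm _ w] at h
  exact eq_neg_of_add_eq_zero_left h

lemma curvature_swap (x : M) (u v w : TangentSpace I x) :
    curvature x u v w = -curvature x v u w := by
  have h : mlieBracket I (extend E u) (extend E v) x = -mlieBracket I (extend E v) (extend E u) x :=
    mlieBracket_swap_apply
  rw [curvature, curvature, curvatureField, curvatureField, h, map_neg]
  abel

end CurvatureSymmetries

section Soliton

variable {E : Type*} [NormedAddCommGroup E] [NormedSpace ℝ E] [FiniteDimensional ℝ E]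
  {H : Type*} [TopologicalSpace H] {I : ModelWithCorners ℝ E H}
  {M : Type*} [TopologicalSpace M] [ChartedSpace H M] [IsManifold I ∞ M]
  [RiemannianBundle (fun x : M ↦ TangentSpace I x)]
  [IsContMDiffRiemannianBundle I ∞ E (fun x : M ↦ TangentSpace I x)]

lemma ricciOp_eq {x : M} {a b : ℝ} {ξ : TangentSpace I x}
    (hS : ∀ u v : TangentSpace I x,
      ricci x u v = a * inner ℝ u v + b * (inner ℝ u ξ * inner ℝ v ξ)) (v : TangentSpace I x) :
    ricciOp x v = a • v + (b * inner ℝ v ξ) • ξ := by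
  conv_rhs => rw [← (stdOrthonormalBasis ℝ (TangentSpace I x)).sum_repr' v]
  conv_rhs => enter [2, 2]; rw [← (stdOrthonormalBasis ℝ (TangentSpace I x)).sum_repr' ξ]
  rw [Finset.smul_sum, Finset.smul_sum, ← Finset.sum_add_distrib, ricciOp,
    (stdOrthonormalBasis ℝ (TangentSpace I x)).sum_repr' v]
  refine Finset.sum_congr rfl fun i _ ↦ ?_
  rw [hS, smul_smul, smul_smul, ← add_smul, real_inner_comm v]
  ring_nf

/-- In dimension three, if the Ricci tensor is `a g + b η ⊗ η` and `W₂(ξ, ·) · S = 0`, then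
`a b = 0`. -/
lemma mul_eq_zero_of_w2 [Nontrivial E] (hdim : Module.finrank ℝ E = 3) {x : M} {a b : ℝ}
    {ξ : TangentSpace I x} (hξ : (inner ℝ ξ ξ : ℝ) = 1)
    (hS : ∀ u v : TangentSpace I x,
      ricci x u v = a * inner ℝ u v + b * (inner ℝ u ξ * inner ℝ v ξ))
    (hW : ∀ u v w : TangentSpace I x,
      ricci x (w2 x ξ u v) w + ricci x v (w2 x ξ u w) = 0) : a * b = 0 := by
  set e := stdOrthonormalBasis ℝ (TangentSpace I x)
  have he : ∀ i, (inner ℝ (e i) (e i) : ℝ) = 1 := fun i ↦ by simp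
  have hterm : ∀ i, -b * inner ℝ (curvature x ξ (e i) ξ) (e i)
      - (a * b + b ^ 2 / 2) * (1 - inner ℝ (e i) ξ * inner ℝ (e i) ξ) = 0 := by
    intro i
    have h1 := hW (e i) ξ (e i)
    have h2 : (inner ℝ (curvature x ξ (e i) ξ) ξ : ℝ) = 0 := by
      linarith [inner_curvature_skew x ξ (e i) ξ ξ]
    have h3 := inner_curvature_skew x ξ (e i) (e i) ξ
    rw [hS, hS] at h1
    simp only [w2, ricciOp_eq hS, inner_add_left, inner_add_right, inner_sub_left, inner_sub_right,
      real_inner_smul_left, real_inner_smul_right, hξ, he, h2,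
      real_inner_comm (curvature x ξ (e i) (e i)) ξ, h3, real_inner_comm (e i) ξ] at h1
    linear_combination h1
  have hsum : ∑ i, (inner ℝ (e i) ξ * inner ℝ (e i) ξ : ℝ) = 1 := by
    rw [← hξ, ← e.sum_inner_mul_inner ξ ξ]
    exact Finset.sum_congr rfl fun i _ ↦ by rw [real_inner_comm ξ]
  have hcard : ∑ _i : Fin (Module.finrank ℝ (TangentSpace I x)), (1 : ℝ) = 3 := by
    have : Module.finrank ℝ (TangentSpace I x) = 3 := hdim
    simp [this]
  have hK : ∑ i, (inner ℝ (curvature x ξ (e i) ξ) (e i) : ℝ) = -(a + b) := by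
    have h : ricci x ξ ξ = a + b := by rw [hS, hξ]; ring
    rw [← h, ricci, ← Finset.sum_neg_distrib]
    exact Finset.sum_congr rfl fun i _ ↦ by rw [curvature_swap, inner_neg_left]
  have htot := Finset.sum_eq_zero fun i (_ : i ∈ Finset.univ) ↦ hterm i
  rw [Finset.sum_sub_distrib, ← Finset.mul_sum, ← Finset.mul_sum, Finset.sum_sub_distrib, hsum,
    hcard, hK] at htot
  linear_combination -htot

namespace AlmostContactMetric

variable (A : AlmostContactMetric I M)

lemma inner_xi_xi (x : M) : (inner ℝ (A.xi x) (A.xi x) : ℝ) = 1 := by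
  rw [← A.eta_apply, A.eta_xi]

lemma phi_xi (x : M) : A.phi x (A.xi x) = 0 := by
  rw [← inner_self_eq_zero (𝕜 := ℝ), A.inner_phi_phi, A.inner_xi_xi, A.eta_xi]
  ring

lemma inner_phi_xi (x : M) (u : TangentSpace I x) : (inner ℝ (A.phi x u) (A.xi x) : ℝ) = 0 := by
  have h := A.inner_phi_skew x u (A.xi x)
  rw [A.phi_xi, inner_zero_right, zero_add, real_inner_comm] at h
  exact h

lemma mdifferentiableAt_xi (x : M) : MDiffAt (T% A.xi) x :=
  (A.smooth_xi x).mdifferentiableAt (by simp)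

lemma inner_leviCivita_xi (x : M) (u : TangentSpace I x) :
    (inner ℝ (leviCivita A.xi x u) (A.xi x) : ℝ) = 0 := by
  have h := leviCivita_metric (mdifferentiableAt_extend I E u) (A.mdifferentiableAt_xi x)
    (A.mdifferentiableAt_xi x)
  have hc : metricFun A.xi A.xi = fun _ : M ↦ (1 : ℝ) := funext A.inner_xi_xi
  rw [hc, mvfderiv_const, extend_apply_self, real_inner_comm _ (A.xi x)] at h
  simp only [zero_apply] at h
  linarith

variable {A} {α β : M → ℝ}

/-- On a trans-Sasakian manifold, `∇_u ξ = -α φu + β (u - η(u) ξ)`. -/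
lemma IsTransSasakian.leviCivita_xi (hA : A.IsTransSasakian α β) (x : M) (u : TangentSpace I x) :
    leviCivita A.xi x u = -α x • A.phi x u + β x • (u - A.eta x u • A.xi x) := by
  have h := hA.covDerivPhi_eq x u A.xi (A.mdifferentiableAt_xi x)
  have h0 : (fun y ↦ A.phi y (A.xi y)) = (0 : Π x : M, TangentSpace I x) := funext A.phi_xi
  rw [covDerivPhi, h0, CovariantDerivative.zero] at h
  rw [A.eta_xi, A.inner_phi_xi, ← A.eta_apply] at h
  have h1 := congrArg (A.phi x) h
  simp only [Pi.zero_apply, zero_apply, zero_sub, map_neg, map_add, map_sub, map_smul, A.phi_xi,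
    A.phi_phi, A.eta_apply x (leviCivita A.xi x u), A.inner_leviCivita_xi, zero_smul, smul_zero,
    one_smul] at h1
  rw [add_zero, neg_neg] at h1
  rw [h1]
  module

lemma IsTransSasakian.lieDerivMetric_xi (hA : A.IsTransSasakian α β) {x : M}
    {X Y : Π x : M, TangentSpace I x} (hX : MDiffAt (T% X) x) (hY : MDiffAt (T% Y) x) :
    lieDerivMetric A.xi X Y x
      = 2 * β x * (inner ℝ (X x) (Y x) - A.eta x (X x) * A.eta x (Y x)) := by
  have hξ := A.mdifferentiableAt_xi x
  have hskew := A.inner_phi_skew x (X x) (Y x)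
  rw [lieDerivMetric, leviCivita_metric hξ hX hY, ← leviCivita_torsion hξ hX,
    ← leviCivita_torsion hξ hY, hA.leviCivita_xi, hA.leviCivita_xi]
  simp only [inner_add_left, inner_add_right, inner_sub_left, inner_sub_right,
    real_inner_smul_left, real_inner_smul_right, A.eta_apply, real_inner_comm (Y x) (A.phi x (X x)),
    real_inner_comm (Y x) (A.xi x)]
  linear_combination (-α x) * hskew

variable {lam mu : ℝ}

lemma IsEtaEinsteinSoliton.ricci_eq_scalarCurvature (hsol : A.IsEtaEinsteinSoliton lam mu)
    (hA : A.IsTransSasakian α β) (x : M) (u v : TangentSpace I x) :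
    ricci x u v = (scalarCurvature I x / 2 - β x - lam) * inner ℝ u v
      + (β x - mu) * (inner ℝ u (A.xi x) * inner ℝ v (A.xi x)) := by
  have hu := mdifferentiableAt_extend I E u
  have hv := mdifferentiableAt_extend I E v
  have h := hsol x _ _ hu hv
  rw [hA.lieDerivMetric_xi hu hv, extend_apply_self, extend_apply_self, A.eta_apply,
    A.eta_apply] at h
  linear_combination h / 2

lemma IsEtaEinsteinSoliton.scalarCurvature_eq (hsol : A.IsEtaEinsteinSoliton lam mu)
    (hA : A.IsTransSasakian α β) (hdim : Module.finrank ℝ E = 3) (x : M) :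
    scalarCurvature I x = 4 * β x + 6 * lam + 2 * mu := by
  set e := stdOrthonormalBasis ℝ (TangentSpace I x)
  have hsum : ∑ i, (inner ℝ (e i) (A.xi x) * inner ℝ (e i) (A.xi x) : ℝ) = 1 := by
    rw [← A.inner_xi_xi x, ← e.sum_inner_mul_inner (A.xi x) (A.xi x)]
    exact Finset.sum_congr rfl fun i _ ↦ by rw [real_inner_comm (A.xi x)]
  have hcard : ∑ i, (inner ℝ (e i) (e i) : ℝ) = 3 := by
    have : Module.finrank ℝ (TangentSpace I x) = 3 := hdim
    simp [this]
  have h : scalarCurvature I x = ∑ i, ricci x (e i) (e i) := rfl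
  simp only [hsol.ricci_eq_scalarCurvature hA x] at h
  rw [Finset.sum_add_distrib, ← Finset.mul_sum, ← Finset.mul_sum, hsum, hcard] at h
  linear_combination -2 * h

/-- The Ricci tensor of an `η`-Einstein soliton on a three-dimensional trans-Sasakian manifold. -/
lemma IsEtaEinsteinSoliton.ricci_eq (hsol : A.IsEtaEinsteinSoliton lam mu)
    (hA : A.IsTransSasakian α β) (hdim : Module.finrank ℝ E = 3) (x : M)
    (u v : TangentSpace I x) :
    ricci x u v = (β x + 2 * lam + mu) * inner ℝ u v
      + (β x - mu) * (inner ℝ u (A.xi x) * inner ℝ v (A.xi x)) := by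
  rw [hsol.ricci_eq_scalarCurvature hA, hsol.scalarCurvature_eq hA hdim]
  ring

lemma IsEtaEinsteinSoliton.beta_eq_or (hsol : A.IsEtaEinsteinSoliton lam mu)
    (hA : A.IsTransSasakian α β) (hdim : Module.finrank ℝ E = 3) (hW : A.W2DotRicciEqZero)
    (x : M) : β x = mu ∨ β x = -(2 * lam + mu) := by
  have : Nontrivial E := Module.nontrivial_of_finrank_pos (R := ℝ) (by omega)
  have h := mul_eq_zero_of_w2 hdim (A.inner_xi_xi x) (hsol.ricci_eq hA hdim x) (hW x)
  rcases mul_eq_zero.1 h with h | h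
  · exact .inr (by linarith)
  · exact .inl (by linarith)

end AlmostContactMetric

end Soliton

end TransSasakian

theorem theorem5p2
    {M : Type*} [TopologicalSpace M] [ChartedSpace (EuclideanSpace ℝ (Fin 3)) M]
    [IsManifold (𝓡 3) ∞ M]
    [RiemannianBundle (fun x : M ↦ TangentSpace (𝓡 3) x)]
    [IsContMDiffRiemannianBundle (𝓡 3) ∞ (EuclideanSpace ℝ (Fin 3))
      (fun x : M ↦ TangentSpace (𝓡 3) x)]
    (A : TransSasakian.AlmostContactMetric (𝓡 3) M) (α β : M → ℝ)
    (hA : A.IsTransSasakian α β)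
    (hM : PreconnectedSpace M ∨ ∃ b : ℝ, ∀ x : M, β x = b)
    (lam mu : ℝ) (hsol : A.IsEtaEinsteinSoliton lam mu)
    (hW : A.W2DotRicciEqZero) :
    (TransSasakian.IsEinstein (𝓡 3) M ∧ ∀ x : M, β x = mu) ∨
    ∃ b : ℝ, (∀ x : M, β x = b) ∧
      (∀ x : M, TransSasakian.scalarCurvature (𝓡 3) x = 2 * lam + 2 * b) ∧
      lam = -(mu + b) / 2 ∧
      (0 < lam ↔ mu < -b) ∧ (lam = 0 ↔ mu = -b) ∧ (lam < 0 ↔ -b < mu) := by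
  have hdim : Module.finrank ℝ (EuclideanSpace ℝ (Fin 3)) = 3 := by simp
  have hβ := hsol.beta_eq_or hA hdim hW
  by_cases hmu : ∀ x, β x = mu
  · refine .inl ⟨⟨2 * mu + 2 * lam, fun x u v ↦ ?_⟩, hmu⟩
    rw [hsol.ricci_eq hA hdim, hmu]
    ring
  push Not at hmu
  obtain ⟨x₀, hx₀⟩ := hmu
  have hconst : ∀ x, β x = β x₀ := by
    intro x
    rcases hM with hM | ⟨b, hb⟩
    · exact isPreconnected_univ.constant_of_mapsTo (Set.toFinite {mu, -(2 * lam + mu)}).isDiscrete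
        hA.smooth_beta.continuous.continuousOn (fun y _ ↦ hβ y) trivial trivial
    · rw [hb, hb]
  have hb : β x₀ = -(2 * lam + mu) := (hβ x₀).resolve_left hx₀
  refine .inr ⟨β x₀, hconst, fun x ↦ ?_, ?_, ?_, ?_, ?_⟩
  · rw [hsol.scalarCurvature_eq hA hdim, hconst]
    linarith
  · linarith
  · constructor <;> intro h <;> linarith
  · constructor <;> intro h <;> linarith
  · constructor <;> intro h <;> linarith
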